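/- Let $K$ be a field, $m\ge 2$, $s\ge 1$. Let $K_m^s$ be the graph obtained from the complete graph on $m$ vertices by attaching $s$ pendant edges at each of its vertices, and let $J(K_m^s)=\bigcap_{ij}(x_i,x_j)$ (intersection over all edges $ij$) be its cover ideal in the standard graded polynomial ring $R$ over $K$ in $m(s+1)$ variables. For an ideal $I$ of $R$ write $I^{(n)}=\bigcap_{\mathfrak q}(I^nR_{\mathfrak q}\cap R)$, over the minimal primes $\mathfrak q$ of $I$, for its $n$-th symbolic power, and for a homogeneous ideal $I$ and $\mathfrak p\in\operatorname{Ass}(R/I)$ let $v_{\mathfrak p}(I)=\min\{u:\ \mathfrak p=(I:f)\text{ for some } f\in R_u\}$. A filtration of ideals $\{I_n\}_{n\ge0}$ (that is, $I_0=R$, $I_rI_s\subseteq I_{r+s}$, and $I_s\subseteq I_r$ for $r\le s$) is called Noetherian if $\bigoplus_{n\ge0}I_n$ is a finitely generated $R$-algebra. For all integers $t\ge1$ and $m\ge2$: (1) Let $J=J(K_m^{t+1})$ and $I_n=J^{(n)}$. Then $\{I_n\}$ is a Noetherian filtration of homogeneous ideals, $\operatorname{Ass}(R/I_n)=\operatorname{Ass}(R/I_{n+1})$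 for all $n\gg0$, and there are two primes $P,Q$ that are maximal in $\operatorname{Ass}(R/I_n)$ for all $n\gg0$ such that both limits below exist and $$\lim_{n\to\infty}\frac{v_Q(I_n)}{n}-\lim_{n\to\infty}\frac{v_P(I_n)}{n}=t.$$ (2) For every $s\ge2$, let $J=J(K_m^s)$ and $I_t=J^{(2t)}$. Then $I_t$ is a homogeneous ideal, $\operatorname{Ass}(R/I_t^n)=\operatorname{Ass}(R/I_t^{n+1})$ for all $n\gg0$, and there are two primes $P,Q$ that are maximal in the stable set $\overline A(I_t)$ of associated primes of $R/I_t^n$, $n\gg0$, such that the limits $\lim_{n\to\infty}v_P(I_t^n)/n$ and $\lim_{n\to\infty}v_Q(I_t^n)/n$ exist and are different. -/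

import Mathlib

open Filter Topology
open scoped Polynomial

section Filtrations

variable {R : Type*} [CommRing R]

/-- A filtration of ideals of `R`: `I 0 = R`, `I r * I s ⊆ I (r + s)`, and `I s ⊆ I r` for
`r ≤ s`. -/
structure IsIdealFiltration (I : ℕ → Ideal R) : Prop where
  zero_eq_top : I 0 = ⊤
  mul_le : ∀ r s, I r * I s ≤ I (r + s)
  antitone : Antitone I

/-- The Rees algebra `⨁ₙ Iₙ` of a filtration, realised as the `R`-subalgebra `⨁ₙ Iₙ Tⁿ` of the
polynomial ring `R[T]`. -/
def filtrationReesAlgebra (I : ℕ → Ideal R) (hI : IsIdealFiltration I) : Subalgebra R R[X] where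
  carrier := {f | ∀ n, f.coeff n ∈ I n}
  mul_mem' := by
    intro f g hf hg n
    rw [Polynomial.coeff_mul]
    refine Ideal.sum_mem _ fun c hc => ?_
    rw [← Finset.HasAntidiagonal.mem_antidiagonal.mp hc]
    exact hI.mul_le _ _ (Ideal.mul_mem_mul (hf c.1) (hg c.2))
  add_mem' := by
    intro f g hf hg n
    rw [Polynomial.coeff_add]
    exact Ideal.add_mem _ (hf n) (hg n)
  algebraMap_mem' := by
    intro r n
    rw [Polynomial.algebraMap_apply, Algebra.algebraMap_self_apply, Polynomial.coeff_C]
    split_ifs with h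
    · rw [h, hI.zero_eq_top]; trivial
    · exact Ideal.zero_mem _

/-- A Noetherian filtration: a filtration whose Rees algebra is a finitely generated
`R`-algebra. -/
def IsNoetherianFiltration (I : ℕ → Ideal R) : Prop :=
  ∃ hI : IsIdealFiltration I, (filtrationReesAlgebra I hI).FG

/-- `Ass (R / Iₙ) = Ass (R / Iₙ₊₁)` for all `n ≫ 0`. -/
def AssStabilizes (I : ℕ → Ideal R) : Prop :=
  ∀ᶠ n in atTop, associatedPrimes R (R ⧸ I n) = associatedPrimes R (R ⧸ I (n + 1))

/-- The primes that lie in `Ass (R / Iₙ)` for all `n ≫ 0`; when `Ass (R / Iₙ)` stabilizes, this is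
the stable value. -/
def stableAss (I : ℕ → Ideal R) : Set (Ideal R) :=
  {P | ∀ᶠ n in atTop, P ∈ associatedPrimes R (R ⧸ I n)}

/-- The `n`-th symbolic power `⋂ (Iⁿ R_Q ∩ R)`, over the minimal primes `Q` of `I`. -/
def symbolicPower (I : Ideal R) (n : ℕ) : Ideal R :=
  ⨅ (Q : Ideal R) (hQ : Q ∈ I.minimalPrimes),
    haveI : Q.IsPrime := hQ.1.1
    ((I ^ n).map (algebraMap R (Localization.AtPrime Q))).comap
      (algebraMap R (Localization.AtPrime Q))

/-- The local `v`-number of `I` at `P`, for `R` graded by `𝒜`: the least `u` such that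
`P = (I : f)` for some `f ∈ 𝒜 u`. (Such `u` exist whenever `R` is Noetherian, `I` is homogeneous
and `P` is an associated prime of `R / I`.) -/
noncomputable def localVNumber {σ : Type*} [SetLike σ R] (𝒜 : ℕ → σ) (P I : Ideal R) : ℕ :=
  sInf {u | ∃ f ∈ 𝒜 u, P = Submodule.colon I {f}}

end Filtrations

section Graphs

/-- The cover ideal `⋂ (x_i, x_j)`, over the edges `ij` of the graph, in `K[x_v : v ∈ V]`. -/
noncomputable def coverIdeal (K : Type*) [Field K] {V : Type*} (G : SimpleGraph V) :
    Ideal (MvPolynomial V K) :=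
  ⨅ (i : V) (j : V) (_ : G.Adj i j), Ideal.span {MvPolynomial.X i, MvPolynomial.X j}

/-- The vertices of `K_m^s`: `inl j` is a vertex of `K_m` and `inr (j, l)` is the `l`-th pendant
vertex at `inl j`. -/
abbrev PendantVertex (m s : ℕ) : Type := Fin m ⊕ Fin m × Fin s

/-- The graph `K_m^s`: the complete graph on `m` vertices (the left summand) with `s` pendant
edges attached to each of its vertices; the pendant vertex `inr (j, l)` is joined to `inl j`. -/
def pendantComplete (m s : ℕ) : SimpleGraph (PendantVertex m s) where
  Adj
    | .inl i, .inl j => i ≠ j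
    | .inl i, .inr p => i = p.1
    | .inr p, .inl i => i = p.1
    | .inr _, .inr _ => False
  symm := ⟨by
    rintro (i | p) (j | q) h
    · exact Ne.symm h
    · exact h
    · exact h
    · exact h⟩
  loopless := ⟨by
    rintro (i | p) h
    · exact h rfl
    · exact h⟩

/-- The standard graded polynomial ring over `K` in the vertices of `K_m^s`. -/
abbrev PendantRing (K : Type*) [Field K] (m s : ℕ) : Type _ := MvPolynomial (PendantVertex m s) K

/-- The standard grading of `PendantRing K m s`. -/
noncomputable abbrev pendantGrading (K : Type*) [Field K] (m s : ℕ) :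
    ℕ → Submodule K (PendantRing K m s) :=
  MvPolynomial.homogeneousSubmodule (PendantVertex m s) K

noncomputable instance instPendantGradedAlgebra (K : Type*) [Field K] (m s : ℕ) :
    GradedAlgebra (pendantGrading K m s) :=
  MvPolynomial.gradedAlgebra

end Graphs

/-! Localizing `J` at the prime of an edge `ij` leaves only `(x_i, x_j)`, so `J^(n)` is the
intersection of the `(x_i, x_j)^n`: the monomial ideal of exponents `a` with `a i + a j ≥ n` on
every edge. These powers are primary, so for `n ≥ 1` the associated primes are exactly the edge
primes. They are pairwise incomparable, hence all maximal.

The `v`-number at `ij` becomes a minimum over exponents: `(J^(n) : x^a) = (x_i, x_j)` when `a` has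
order `n` on all edges except `ij` and misses it there by one (`colon_monomial_eq`). Any `f` with
this colon has such an `a` in its support (`exists_isCoverExceptAt_of_eq_colon`).

At a pendant edge the minimum is `mn + O(1)`: each of the `m` stars costs about `n`. At an edge of
`K_m` the two ends share only `n - 1`, so any two leaves, one at each end, weigh at least `2n - (n -
1) = n + 1` together. The `s` such pairs give slope `m - 1 + s`. The slopes differ by `s - 1`, which
is `t` for `s = t + 1`.

Finally `J^(n+2) = J^(2) J^(n)`, by splitting covers. This makes the filtration Noetherian and gives
`(J^(2t))^n = J^(2tn)`, so in part (2) both slopes are multiplied by `2t`. -/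

/-! ### Powers of the primes `(x_i, x_j)`. -/

section EdgeIdeals

open MvPolynomial

variable {K : Type*} [Field K] {V : Type*}

/-- The weight on exponents counting the variables `i` and `j`. -/
noncomputable def pairWeight (i j : V) : V → ℕ := by
  classical exact Pi.single i 1 + Pi.single j 1

lemma weight_pairWeight (i j : V) (a : V →₀ ℕ) :
    Finsupp.weight (pairWeight i j) a = a i + a j := by
  classical
  rw [Finsupp.weight_apply, Finsupp.sum]
  simp only [pairWeight, Pi.add_apply, smul_eq_mul, Pi.single_apply, mul_add,
    Finset.sum_add_distrib, mul_ite, mul_one, mul_zero, Finset.sum_ite_eq', Finsupp.mem_support_iff]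
  split_ifs <;> simp_all

/-- Passing to the weighted order of a power series makes the exponent condition a valuation,
additive on products. -/
lemma le_weightedOrder_pairWeight_iff (i j : V) (n : ℕ) (f : MvPolynomial V K) :
    (n : ℕ∞) ≤ (f : MvPowerSeries V K).weightedOrder (pairWeight i j) ↔
      ∀ a ∈ f.support, n ≤ a i + a j := by
  constructor
  · intro h a ha
    have h1 := MvPowerSeries.weightedOrder_le (pairWeight i j) (f := (f : MvPowerSeries V K))
      (d := a) (by simpa using ha)
    rw [weight_pairWeight] at h1
    exact_mod_cast h.trans h1
  · intro h
    refine MvPowerSeries.nat_le_weightedOrder _ fun d hd => ?_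
    by_contra h0
    have := h d (by simpa using h0)
    rw [weight_pairWeight] at hd
    omega

lemma mem_pairIdeal_pow_iff {i j : V} (hij : i ≠ j) (n : ℕ) (f : MvPolynomial V K) :
    f ∈ (Ideal.span {X i, X j} : Ideal (MvPolynomial V K)) ^ n ↔
      ∀ a ∈ f.support, n ≤ a i + a j := by
  classical
  constructor
  · rw [← le_weightedOrder_pairWeight_iff]
    induction n generalizing f with
    | zero => simp
    | succ n ih =>
      intro hf
      rw [pow_succ'] at hf
      refine Submodule.mul_induction_on hf ?_ ?_
      · intro g hg h hh
        have h1 : ((1 : ℕ) : ℕ∞) ≤ (g : MvPowerSeries V K).weightedOrder (pairWeight i j) := by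
          rw [le_weightedOrder_pairWeight_iff]
          intro a ha
          have : g ∈ Ideal.span (X '' ({i, j} : Set V)) := by
            simpa [Set.image_pair] using hg
          obtain ⟨k, hk, hk'⟩ := mem_ideal_span_X_image.1 this a ha
          rcases hk with rfl | rfl <;> omega
        have h2 := ih h hh
        rw [coe_mul]
        refine le_trans ?_ (MvPowerSeries.le_weightedOrder_mul _)
        push_cast
        rw [add_comm]
        exact add_le_add h1 h2
      · intro g h hg hh
        rw [coe_add]
        exact (le_min hg hh).trans (MvPowerSeries.min_weightedOrder_le_add _)
  · intro h
    rw [f.as_sum]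
    refine Ideal.sum_mem _ fun a ha => ?_
    have hn := h a ha
    have hdecomp : a = (a - (Finsupp.single i (a i) + Finsupp.single j (a j))) +
        (Finsupp.single i (a i) + Finsupp.single j (a j)) := by
      refine (tsub_add_cancel_of_le ?_).symm
      intro k
      simp only [Finsupp.add_apply, Finsupp.single_apply]
      split_ifs with h1 h2 h2
      · exact absurd (h1.trans h2.symm) hij
      · simp [h1]
      · simp [h2]
      · simp
    have : monomial a (coeff a f) =
        monomial (a - (Finsupp.single i (a i) + Finsupp.single j (a j))) (coeff a f) *
          (X i ^ a i * X j ^ a j) := by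
      rw [X_pow_eq_monomial, X_pow_eq_monomial, monomial_mul, monomial_mul, ← hdecomp]
      simp
    rw [this]
    refine Ideal.mul_mem_left _ _ (Ideal.pow_le_pow_right hn ?_)
    rw [pow_add]
    exact Ideal.mul_mem_mul (Ideal.pow_mem_pow (Ideal.subset_span (by simp)) _)
      (Ideal.pow_mem_pow (Ideal.subset_span (by simp)) _)

lemma mem_pairIdeal_iff {i j : V} (hij : i ≠ j) (f : MvPolynomial V K) :
    f ∈ (Ideal.span {X i, X j} : Ideal (MvPolynomial V K)) ↔
      ∀ a ∈ f.support, 1 ≤ a i + a j := by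
  rw [← mem_pairIdeal_pow_iff hij, pow_one]

/-- Powers of `(x_i, x_j)` are primary: an element outside the prime has order `0`, and order is
additive over a field. -/
lemma mem_pairIdeal_pow_of_mul_mem {i j : V} (hij : i ≠ j) {n : ℕ} {f g : MvPolynomial V K}
    (hg : g ∉ (Ideal.span {X i, X j} : Ideal (MvPolynomial V K)))
    (hfg : g * f ∈ (Ideal.span {X i, X j} : Ideal (MvPolynomial V K)) ^ n) :
    f ∈ (Ideal.span {X i, X j} : Ideal (MvPolynomial V K)) ^ n := by
  rw [mem_pairIdeal_pow_iff hij, ← le_weightedOrder_pairWeight_iff] at hfg ⊢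
  rw [mem_pairIdeal_iff hij, ← le_weightedOrder_pairWeight_iff] at hg
  have hg0 : (g : MvPowerSeries V K).weightedOrder (pairWeight i j) = 0 := by
    simpa using hg
  rwa [coe_mul, MvPowerSeries.weightedOrder_mul, hg0, zero_add] at hfg

lemma isPrime_pairIdeal {i j : V} (hij : i ≠ j) :
    (Ideal.span {X i, X j} : Ideal (MvPolynomial V K)).IsPrime := by
  refine ⟨fun h => ?_, fun {f g} h => ?_⟩
  · have := (Ideal.eq_top_iff_one _).1 h
    rw [mem_pairIdeal_iff hij] at this
    simpa using this 0 (by simp)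
  · by_contra! hn
    refine hn.2 ?_
    have := mem_pairIdeal_pow_of_mul_mem (n := 1) hij hn.1 (by simpa using h)
    simpa using this

lemma pairIdeal_le_pairIdeal {i j k l : V} (hij : i ≠ j) (hkl : k ≠ l)
    (h : (Ideal.span {X i, X j} : Ideal (MvPolynomial V K)) ≤ Ideal.span {X k, X l}) :
    (Ideal.span {X i, X j} : Ideal (MvPolynomial V K)) = Ideal.span {X k, X l} := by
  classical
  have hi : (X i : MvPolynomial V K) ∈ Ideal.span {X k, X l} := h (Ideal.subset_span (by simp))
  have hj : (X j : MvPolynomial V K) ∈ Ideal.span {X k, X l} := h (Ideal.subset_span (by simp))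
  rw [mem_pairIdeal_iff hkl] at hi hj
  have hi := hi (Finsupp.single i 1) (by simp [support_X])
  have hj := hj (Finsupp.single j 1) (by simp [support_X])
  have hi' : i = k ∨ i = l := by
    by_contra! hc
    simp [hc.1, hc.2] at hi
  have hj' : j = k ∨ j = l := by
    by_contra! hc
    simp [hc.1, hc.2] at hj
  rcases hi' with rfl | rfl <;> rcases hj' with rfl | rfl
  · exact absurd rfl hij
  · rfl
  · rw [Set.pair_comm]
  · exact absurd rfl hij

end EdgeIdeals

/-! ### Symbolic powers as intersections over edges. -/

section CoverIdeals

open MvPolynomial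

variable {K : Type*} [Field K] {V : Type*} {G : SimpleGraph V}

/-- `a` is a vertex cover of order `n`: `n ≤ a i + a j` for every edge `ij`. -/
def IsVertexCover (G : SimpleGraph V) (n : ℕ) (a : V →₀ ℕ) : Prop :=
  ∀ i j, G.Adj i j → n ≤ a i + a j

lemma exists_pairIdeal_le_of_iInf_le [Finite V] {Q : Ideal (MvPolynomial V K)} (hQ : Q.IsPrime)
    (I : V → V → Ideal (MvPolynomial V K))
    (h : ⨅ (i : V) (j : V) (_ : G.Adj i j), I i j ≤ Q) :
    ∃ i j, G.Adj i j ∧ I i j ≤ Q := by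
  classical
  have := Fintype.ofFinite V
  have h' : (Finset.univ.filter fun e : V × V => G.Adj e.1 e.2).inf (fun e => I e.1 e.2) ≤ Q := by
    refine le_trans (le_iInf₂ fun i j => le_iInf fun hij => ?_) h
    exact Finset.inf_le (f := fun e : V × V => I e.1 e.2) (b := (i, j)) (by simpa using hij)
  obtain ⟨e, he, hle⟩ := hQ.inf_le'.1 h'
  exact ⟨e.1, e.2, by simpa using he, hle⟩

lemma coverIdeal_le {i j : V} (h : G.Adj i j) :
    coverIdeal K G ≤ Ideal.span {X i, X j} :=
  iInf_le_of_le i (iInf_le_of_le j (iInf_le _ h))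

lemma mem_minimalPrimes_coverIdeal_iff [Finite V] (Q : Ideal (MvPolynomial V K)) :
    Q ∈ (coverIdeal K G).minimalPrimes ↔ ∃ i j, G.Adj i j ∧ Q = Ideal.span {X i, X j} := by
  constructor
  · rintro ⟨⟨hQ, hle⟩, hmin⟩
    obtain ⟨i, j, hij, h⟩ := exists_pairIdeal_le_of_iInf_le hQ _ hle
    exact ⟨i, j, hij, le_antisymm (hmin ⟨isPrime_pairIdeal hij.ne, coverIdeal_le hij⟩ h) h⟩
  · rintro ⟨i, j, hij, rfl⟩
    refine ⟨⟨isPrime_pairIdeal hij.ne, coverIdeal_le hij⟩, fun Q ⟨hQ, hle⟩ hQle => ?_⟩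
    obtain ⟨k, l, hkl, h⟩ := exists_pairIdeal_le_of_iInf_le hQ _ hle
    exact (pairIdeal_le_pairIdeal hkl.ne hij.ne (h.trans hQle)).ge.trans h

lemma comap_map_coverIdeal_pow [Finite V] {i j : V} (hij : G.Adj i j) (n : ℕ)
    [(Ideal.span {X i, X j} : Ideal (MvPolynomial V K)).IsPrime] :
    ((coverIdeal K G ^ n).map (algebraMap (MvPolynomial V K) (Localization.AtPrime
      (Ideal.span {X i, X j} : Ideal (MvPolynomial V K))))).comap
      (algebraMap (MvPolynomial V K) (Localization.AtPrime
        (Ideal.span {X i, X j} : Ideal (MvPolynomial V K)))) =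
      Ideal.span {X i, X j} ^ n := by
  classical
  have := Fintype.ofFinite V
  ext f
  rw [Ideal.mem_comap, IsLocalization.algebraMap_mem_map_algebraMap_iff
    (Ideal.span {X i, X j} : Ideal (MvPolynomial V K)).primeCompl]
  constructor
  · rintro ⟨g, hg, hgf⟩
    exact mem_pairIdeal_pow_of_mul_mem hij.ne hg (Ideal.pow_right_mono (coverIdeal_le hij) n hgf)
  · intro hf
    -- The product of all other variables is a unit at `(x_i, x_j)` and lies in every other edge
    -- prime, so it carries `(x_i, x_j)` into the cover ideal.
    set s : MvPolynomial V K := ∏ k ∈ Finset.univ.filter (fun k => k ≠ i ∧ k ≠ j), X k with hs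
    have hsP : s ∉ (Ideal.span {X i, X j} : Ideal (MvPolynomial V K)) := by
      rw [hs, Ideal.IsPrime.prod_mem_iff]
      rintro ⟨k, hk, hk'⟩
      rw [mem_pairIdeal_iff hij.ne] at hk'
      have := hk' (Finsupp.single k 1) (by simp [support_X])
      simp only [Finset.mem_filter, Finset.mem_univ, true_and] at hk
      simp [hk.1, hk.2] at this
    have hsJ : ∀ g ∈ (Ideal.span {X i, X j} : Ideal (MvPolynomial V K)), s * g ∈ coverIdeal K G := by
      intro g hg
      simp only [coverIdeal, Ideal.mem_iInf]
      intro k l hkl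
      by_cases hk : k = i ∨ k = j
      · by_cases hl : l = i ∨ l = j
        · have : (Ideal.span {X k, X l} : Ideal (MvPolynomial V K)) = Ideal.span {X i, X j} := by
            rcases hk with rfl | rfl <;> rcases hl with rfl | rfl
            · exact absurd rfl hkl.ne
            · rfl
            · rw [Set.pair_comm]
            · exact absurd rfl hkl.ne
          rw [this]
          exact Ideal.mul_mem_left _ _ hg
        · push Not at hl
          refine Ideal.mul_mem_right _ _ (Ideal.mem_of_dvd _ (Finset.dvd_prod_of_mem _
            (a := l) (by simpa using hl)) (Ideal.subset_span (by simp)))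
      · push Not at hk
        refine Ideal.mul_mem_right _ _ (Ideal.mem_of_dvd _ (Finset.dvd_prod_of_mem _
            (a := k) (by simpa using hk)) (Ideal.subset_span (by simp)))
    refine ⟨s ^ n, ?_, ?_⟩
    · exact fun h => hsP (Ideal.IsPrime.mem_of_pow_mem ‹_› _ h)
    · have hle : Ideal.span {s} * Ideal.span {X i, X j} ≤ coverIdeal K G := by
        rw [Ideal.mul_le]
        intro r hr g hg
        obtain ⟨c, rfl⟩ := Ideal.mem_span_singleton'.1 hr
        rw [mul_assoc]
        exact Ideal.mul_mem_left _ _ (hsJ g hg)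
      refine Ideal.pow_right_mono hle n ?_
      rw [mul_pow]
      exact Ideal.mul_mem_mul (Ideal.pow_mem_pow (Ideal.mem_span_singleton_self s) n) hf

lemma symbolicPower_coverIdeal_eq [Finite V] (n : ℕ) :
    symbolicPower (coverIdeal K G) n =
      ⨅ (i : V) (j : V) (_ : G.Adj i j), (Ideal.span {X i, X j}) ^ n := by
  refine le_antisymm (le_iInf₂ fun i j => le_iInf fun hij => ?_) (le_iInf₂ fun Q hQ => ?_)
  · have := isPrime_pairIdeal (K := K) hij.ne
    refine (iInf₂_le _ ((mem_minimalPrimes_coverIdeal_iff _).2 ⟨i, j, hij, rfl⟩)).trans ?_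
    exact (comap_map_coverIdeal_pow hij n).le
  · obtain ⟨i, j, hij, rfl⟩ := (mem_minimalPrimes_coverIdeal_iff _).1 hQ
    have := isPrime_pairIdeal (K := K) hij.ne
    exact (iInf_le_of_le i (iInf_le_of_le j (iInf_le _ hij))).trans
      (comap_map_coverIdeal_pow hij n).ge

lemma mem_symbolicPower_coverIdeal_iff [Finite V] (n : ℕ) (f : MvPolynomial V K) :
    f ∈ symbolicPower (coverIdeal K G) n ↔ ∀ a ∈ f.support, IsVertexCover G n a := by
  simp only [symbolicPower_coverIdeal_eq, Ideal.mem_iInf, IsVertexCover]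
  constructor
  · intro h a ha i j hij
    exact (mem_pairIdeal_pow_iff hij.ne n f).1 (h i j hij) a ha
  · intro h i j hij
    exact (mem_pairIdeal_pow_iff hij.ne n f).2 fun a ha => h a ha i j hij

lemma monomial_mem_symbolicPower_coverIdeal [Finite V] {n : ℕ} {a : V →₀ ℕ} (ha : IsVertexCover G n a)
    (c : K) : monomial a c ∈ symbolicPower (coverIdeal K G) n := by
  classical
  rw [mem_symbolicPower_coverIdeal_iff]
  intro b hb
  rw [Finset.mem_singleton.1 (support_monomial_subset hb)]
  exact ha

attribute [local instance] MvPolynomial.gradedAlgebra in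
lemma isHomogeneous_symbolicPower_coverIdeal [Finite V] (n : ℕ) :
    (symbolicPower (coverIdeal K G) n).IsHomogeneous (homogeneousSubmodule V K) := by
  intro d f hf
  rw [mem_symbolicPower_coverIdeal_iff] at hf ⊢
  intro a ha
  refine hf a ?_
  rw [show (DirectSum.decompose (homogeneousSubmodule V K) f d : MvPolynomial V K) =
    homogeneousComponent d f from decomposition.decompose'_apply f d,
    mem_support_iff, coeff_homogeneousComponent] at ha
  rw [mem_support_iff]
  exact fun h => ha (by simp [h])

end CoverIdeals

/-! ### Splitting off covers of order two. -/

section CoverFiltration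

open MvPolynomial

variable {K : Type*} [Field K] {V : Type*} [Finite V] {G : SimpleGraph V}

omit [Finite V] in
lemma IsVertexCover.add {m n : ℕ} {a b : V →₀ ℕ} (ha : IsVertexCover G m a)
    (hb : IsVertexCover G n b) : IsVertexCover G (m + n) (a + b) := by
  intro i j hij
  have h1 := ha i j hij
  have h2 := hb i j hij
  simp only [Finsupp.add_apply]
  omega

omit [Finite V] in
/-- A vertex cover of order `n + 2` is the sum of one of order `2` and one of order `n`. -/
lemma IsVertexCover.exists_add {n : ℕ} {a : V →₀ ℕ} (ha : IsVertexCover G (n + 2) a) :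
    ∃ b c, IsVertexCover G 2 b ∧ IsVertexCover G n c ∧ b + c = a := by
  -- An edge with a zero end has its other end at least `n + 2`, which gives up `2`; otherwise both
  -- ends give up at least `1`. An end that is at least `n + 2` keeps `n`; if neither is, each gives
  -- up exactly `1`, leaving `n` in total.
  let φ : ℕ → ℕ := fun x => if x = 0 then 0 else if x < n + 2 then 1 else 2
  have hφ0 : φ 0 = 0 := rfl
  refine ⟨a.mapRange φ hφ0, a - a.mapRange φ hφ0, ?_, ?_, ?_⟩
  · intro i j hij
    have := ha i j hij
    simp only [Finsupp.mapRange_apply, φ]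
    split_ifs <;> omega
  · intro i j hij
    have := ha i j hij
    simp only [Finsupp.coe_tsub, Pi.sub_apply, Finsupp.mapRange_apply, φ]
    split_ifs <;> omega
  · refine add_tsub_cancel_of_le fun i => ?_
    simp only [Finsupp.mapRange_apply, φ]
    split_ifs <;> omega

lemma symbolicPower_coverIdeal_mul_le (m n : ℕ) :
    symbolicPower (coverIdeal K G) m * symbolicPower (coverIdeal K G) n ≤
      symbolicPower (coverIdeal K G) (m + n) := by
  classical
  rw [Ideal.mul_le]
  intro f hf g hg
  rw [mem_symbolicPower_coverIdeal_iff] at hf hg ⊢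
  intro a ha
  obtain ⟨b, hb, c, hc, rfl⟩ := Finset.mem_add.1 (support_mul f g ha)
  exact (hf b hb).add (hg c hc)

lemma symbolicPower_coverIdeal_add_two (n : ℕ) :
    symbolicPower (coverIdeal K G) (n + 2) =
      symbolicPower (coverIdeal K G) 2 * symbolicPower (coverIdeal K G) n := by
  refine le_antisymm (fun f hf => ?_) ?_
  · rw [f.as_sum]
    refine Ideal.sum_mem _ fun a ha => ?_
    obtain ⟨b, c, hb, hc, rfl⟩ := ((mem_symbolicPower_coverIdeal_iff _ f).1 hf a ha).exists_add
    rw [← one_mul (coeff (b + c) f), ← monomial_mul]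
    exact Ideal.mul_mem_mul (monomial_mem_symbolicPower_coverIdeal hb _)
      (monomial_mem_symbolicPower_coverIdeal hc _)
  · rw [add_comm]
    exact symbolicPower_coverIdeal_mul_le 2 n

lemma symbolicPower_coverIdeal_zero : symbolicPower (coverIdeal K G) 0 = ⊤ := by
  refine Ideal.eq_top_iff_one _ |>.2 ?_
  rw [mem_symbolicPower_coverIdeal_iff]
  exact fun a _ i j _ => Nat.zero_le _

lemma symbolicPower_coverIdeal_two_mul (n : ℕ) :
    symbolicPower (coverIdeal K G) (2 * n) = symbolicPower (coverIdeal K G) 2 ^ n := by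
  induction n with
  | zero => rw [mul_zero, symbolicPower_coverIdeal_zero, pow_zero, Ideal.one_eq_top]
  | succ n ih => rw [mul_add, mul_one, symbolicPower_coverIdeal_add_two, ih, pow_succ']

lemma symbolicPower_coverIdeal_two_mul_pow (t n : ℕ) :
    symbolicPower (coverIdeal K G) (2 * t) ^ n = symbolicPower (coverIdeal K G) (2 * t * n) := by
  rw [symbolicPower_coverIdeal_two_mul, ← pow_mul, mul_assoc, symbolicPower_coverIdeal_two_mul]

lemma isIdealFiltration_symbolicPower_coverIdeal :
    IsIdealFiltration (symbolicPower (coverIdeal K G)) where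
  zero_eq_top := symbolicPower_coverIdeal_zero
  mul_le := symbolicPower_coverIdeal_mul_le
  antitone := by
    intro m n hmn f hf
    rw [mem_symbolicPower_coverIdeal_iff] at hf ⊢
    exact fun a ha i j hij => hmn.trans (hf a ha i j hij)

/-- A filtration with `I (n + 2) = I 2 * I n` over a Noetherian ring is Noetherian. -/
lemma isNoetherianFiltration_of_add_two {R : Type*} [CommRing R] [IsNoetherianRing R]
    {I : ℕ → Ideal R} (hI : IsIdealFiltration I) (h2 : ∀ n, I (n + 2) = I 2 * I n) :
    IsNoetherianFiltration I := by
  classical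
  refine ⟨hI, ?_⟩
  have hfg : ∀ n, ∃ S : Finset R, Ideal.span (S : Set R) = I n := fun n =>
    (isNoetherianRing_iff_ideal_fg R).1 ‹_› (I n)
  choose S hS using hfg
  let gens (n : ℕ) : Finset R[X] := (S n).image (Polynomial.monomial n)
  refine ⟨gens 1 ∪ gens 2, le_antisymm (Algebra.adjoin_le ?_) fun f hf => ?_⟩
  · have key : ∀ n, ∀ p ∈ gens n, p ∈ filtrationReesAlgebra I hI := by
      intro n p hp k
      obtain ⟨r, hr, rfl⟩ := Finset.mem_image.1 hp
      rw [Polynomial.coeff_monomial]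
      split_ifs with hk
      · rw [← hk, ← hS n]
        exact Ideal.subset_span hr
      · exact Ideal.zero_mem _
    intro p hp
    rcases Finset.mem_union.1 (Finset.mem_coe.1 hp) with h | h
    · exact key 1 p h
    · exact key 2 p h
  · set A := Algebra.adjoin R ((gens 1 ∪ gens 2 : Finset R[X]) : Set R[X]) with hA
    have hgen : ∀ n, gens n ⊆ gens 1 ∪ gens 2 → ∀ r ∈ I n, Polynomial.monomial n r ∈ A := by
      intro n hn r hr
      rw [← hS n] at hr
      refine Submodule.span_induction ?_ ?_ ?_ ?_ hr
      · intro x hx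
        exact Algebra.subset_adjoin (hn (Finset.mem_image_of_mem _ hx))
      · rw [map_zero]
        exact A.zero_mem
      · intro x y _ _ hx hy
        rw [map_add]
        exact A.add_mem hx hy
      · intro c x _ hx
        rw [map_smul]
        exact A.smul_mem hx c
    have hmon : ∀ n, ∀ r ∈ I n, Polynomial.monomial n r ∈ A := by
      intro n
      induction n using Nat.strong_induction_on with
      | _ n ih =>
        match n, ih with
        | 0, _ => exact fun r _ => A.algebraMap_mem r
        | 1, _ => exact hgen 1 Finset.subset_union_left
        | n + 2, ih =>
          intro r hr
          rw [h2] at hr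
          refine Submodule.mul_induction_on hr ?_ ?_
          · intro x hx y hy
            rw [add_comm, ← Polynomial.monomial_mul_monomial]
            exact A.mul_mem (hgen 2 Finset.subset_union_right x hx) (ih n (by omega) y hy)
          · intro x y hx hy
            rw [map_add]
            exact A.add_mem hx hy
    rw [f.as_sum_support]
    exact A.sum_mem fun n _ => hmon n _ (hf n)

lemma isNoetherianFiltration_symbolicPower_coverIdeal :
    IsNoetherianFiltration (symbolicPower (coverIdeal K G)) :=
  isNoetherianFiltration_of_add_two isIdealFiltration_symbolicPower_coverIdeal
    symbolicPower_coverIdeal_add_two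

end CoverFiltration

/-! ### Associated primes and local `v`-numbers through exponents. -/

section AssociatedPrimes

open MvPolynomial

variable {K : Type*} [Field K] {V : Type*} [Finite V] {G : SimpleGraph V}

/-- `a` attains order `n` on every edge except `ij`, where it falls short by exactly one. -/
def IsCoverExceptAt (G : SimpleGraph V) (n : ℕ) (i j : V) (a : V →₀ ℕ) : Prop :=
  a i + a j + 1 = n ∧
    ∀ k l, G.Adj k l → ¬ (k = i ∧ l = j) → ¬ (k = j ∧ l = i) → n ≤ a k + a l

lemma colon_monomial_eq {i j : V} (hij : G.Adj i j) {n : ℕ} {a : V →₀ ℕ}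
    (ha : IsCoverExceptAt G n i j a) :
    Submodule.colon (symbolicPower (coverIdeal K G) n) {monomial a (1 : K)} =
      Ideal.span {X i, X j} := by
  classical
  refine le_antisymm (fun f hf => ?_) ?_
  · rw [Submodule.mem_colon_singleton, smul_eq_mul, mem_symbolicPower_coverIdeal_iff] at hf
    rw [mem_pairIdeal_iff hij.ne]
    intro b hb
    have := hf (b + a) (by simpa using hb) i j hij
    have := ha.1
    simp only [Finsupp.add_apply] at *
    omega
  · have key : ∀ k, k = i ∨ k = j →
        (X k : MvPolynomial V K) ∈
          Submodule.colon (symbolicPower (coverIdeal K G) n) {monomial a (1 : K)} := by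
      intro k hk
      rw [Submodule.mem_colon_singleton, smul_eq_mul, X, monomial_mul]
      refine monomial_mem_symbolicPower_coverIdeal (fun p q hpq => ?_) _
      simp only [Finsupp.add_apply]
      by_cases h1 : p = i ∧ q = j
      · obtain ⟨rfl, rfl⟩ := h1
        have := ha.1
        rcases hk with rfl | rfl <;> simp <;> omega
      · by_cases h2 : p = j ∧ q = i
        · obtain ⟨rfl, rfl⟩ := h2
          have := ha.1
          rcases hk with rfl | rfl <;> simp <;> omega
        · have := ha.2 p q hpq h1 h2
          omega
    rw [Ideal.span_le]
    rintro _ (rfl | rfl)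
    · exact key i (Or.inl rfl)
    · exact key j (Or.inr rfl)

/-- Some `a` in the support of `f` is not a cover. Multiplication by a variable shifts the support
without cancellation, so raising `a` at `i`, or at `j`, gives a cover. Every deficient edge thus
contains both `i` and `j`, and its deficit is one. -/
lemma exists_isCoverExceptAt_of_eq_colon {i j : V} {n : ℕ} {f : MvPolynomial V K}
    (h : Ideal.span {X i, X j} = Submodule.colon (symbolicPower (coverIdeal K G) n) {f})
    (hij : G.Adj i j) :
    ∃ a ∈ f.support, IsCoverExceptAt G n i j a := by
  classical
  have hf : f ∉ symbolicPower (coverIdeal K G) n := by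
    intro hf
    refine (isPrime_pairIdeal (K := K) hij.ne).ne_top ?_
    rw [h, Ideal.eq_top_iff_one, Submodule.mem_colon_singleton]
    simpa using hf
  rw [mem_symbolicPower_coverIdeal_iff] at hf
  push Not at hf
  obtain ⟨a, ha, hna⟩ := hf
  have key : ∀ k, k = i ∨ k = j → IsVertexCover G n (Finsupp.single k 1 + a) := by
    intro k hk
    have hX : (X k : MvPolynomial V K) ∈
        Submodule.colon (symbolicPower (coverIdeal K G) n) {f} := by
      rw [← h]
      exact Ideal.subset_span (by rcases hk with rfl | rfl <;> simp)
    rw [Submodule.mem_colon_singleton, smul_eq_mul, mem_symbolicPower_coverIdeal_iff] at hX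
    refine hX _ ?_
    rw [mem_support_iff, coeff_X_mul]
    exact mem_support_iff.1 ha
  have hi := key i (Or.inl rfl)
  have hj := key j (Or.inr rfl)
  unfold IsVertexCover at hna
  push Not at hna
  obtain ⟨k, l, hkl, hlt⟩ := hna
  have main : ∀ p q, G.Adj p q → a p + a q < n → (p = i ∨ q = i) ∧ (p = j ∨ q = j) := by
    intro p q hpq hlt
    have h1 := hi p q hpq
    have h2 := hj p q hpq
    simp only [Finsupp.add_apply, Finsupp.single_apply] at h1 h2
    have := hpq.ne
    constructor
    · by_contra! hc
      simp only [hc.1.symm, hc.2.symm, if_false] at h1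
      omega
    · by_contra! hc
      simp only [hc.1.symm, hc.2.symm, if_false] at h2
      omega
  have hne := hij.ne
  have hsum : a i + a j < n := by
    obtain ⟨h1 | h1, h2 | h2⟩ := main k l hkl hlt <;> subst h1 <;> try subst h2
    all_goals first | omega | exact absurd rfl hne
  refine ⟨a, ha, ?_, fun p q hpq h1 h2 => ?_⟩
  · have := hi i j hij
    simp only [Finsupp.add_apply, Finsupp.single_eq_same, Finsupp.single_apply, hne,
      if_false] at this
    omega
  · by_contra! hlt
    obtain ⟨h3 | h3, h4 | h4⟩ := main p q hpq hlt
    · exact hne (h3.symm.trans h4)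
    · exact h1 ⟨h3, h4⟩
    · exact h2 ⟨h4, h3⟩
    · exact hne (h3.symm.trans h4)

lemma mem_associatedPrimes_quotient_iff {R : Type*} [CommRing R] [IsNoetherianRing R]
    (I Q : Ideal R) :
    Q ∈ associatedPrimes R (R ⧸ I) ↔ Q.IsPrime ∧ ∃ f, Q = Submodule.colon I {f} := by
  have hcolon : ∀ f : R, Submodule.colon (⊥ : Submodule R (R ⧸ I)) {Ideal.Quotient.mk I f} =
      Submodule.colon I {f} := by
    intro f
    ext r
    rw [Submodule.mem_colon_singleton, Submodule.mem_colon_singleton, Submodule.mem_bot,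
      ← Ideal.Quotient.eq_zero_iff_mem]
    rfl
  rw [AssociatedPrimes.mem_iff, isAssociatedPrime_iff]
  refine and_congr_right fun _ => ⟨?_, ?_⟩
  · rintro ⟨x, hx⟩
    obtain ⟨f, rfl⟩ := Ideal.Quotient.mk_surjective x
    exact ⟨f, hx.trans (hcolon f)⟩
  · rintro ⟨f, hf⟩
    exact ⟨Ideal.Quotient.mk I f, hf.trans (hcolon f).symm⟩

lemma exists_isCoverExceptAt {n : ℕ} (hn : 1 ≤ n) {i j : V} (hij : i ≠ j) :
    ∃ a, IsCoverExceptAt G n i j a := by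
  classical
  -- Every edge other than `ij` has an end outside `{i, j}`, where the value is `n`.
  refine ⟨Finsupp.equivFunOnFinite.symm
    (fun k => if k = i then n - 1 else if k = j then 0 else n), ?_, fun k l hkl h1 h2 => ?_⟩
  · simp [hij.symm]
    omega
  · have := hkl.ne
    simp only [Finsupp.equivFunOnFinite_symm_apply_apply]
    split_ifs <;> first | omega | simp_all

/-- A prime colon `Q` contains `(P^n : f)` for some edge prime `P`, hence `P^n` and so `P`. An
element of `Q` outside `P` would put `f` in `P^n`, making that colon the whole ring. -/
lemma associatedPrimes_symbolicPower_coverIdeal {n : ℕ} (hn : 1 ≤ n) :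
    associatedPrimes (MvPolynomial V K) (MvPolynomial V K ⧸ symbolicPower (coverIdeal K G) n) =
      {Q | ∃ i j, G.Adj i j ∧ Q = Ideal.span {X i, X j}} := by
  ext Q
  rw [mem_associatedPrimes_quotient_iff]
  change _ ↔ ∃ i j, G.Adj i j ∧ Q = Ideal.span {X i, X j}
  constructor
  · rintro ⟨hQ, f, hf⟩
    have h : ⨅ (i : V) (j : V) (_ : G.Adj i j),
        Submodule.colon ((Ideal.span {X i, X j} : Ideal (MvPolynomial V K)) ^ n) {f} ≤ Q := by
      intro g hg
      rw [hf, Submodule.mem_colon_singleton, symbolicPower_coverIdeal_eq]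
      simp only [Ideal.mem_iInf, Submodule.mem_colon_singleton] at hg ⊢
      exact hg
    obtain ⟨i, j, hij, hle⟩ := exists_pairIdeal_le_of_iInf_le hQ _ h
    have hP := isPrime_pairIdeal (K := K) hij.ne
    have hQle : ∀ g ∈ Q, g * f ∈ (Ideal.span {X i, X j} : Ideal (MvPolynomial V K)) ^ n := by
      intro g hg
      rw [hf, Submodule.mem_colon_singleton, symbolicPower_coverIdeal_eq] at hg
      simp only [Ideal.mem_iInf] at hg
      exact hg i j hij
    refine ⟨i, j, hij, le_antisymm (fun g hg => ?_) ?_⟩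
    · by_contra hgP
      have hfn := mem_pairIdeal_pow_of_mul_mem hij.ne hgP (hQle g hg)
      refine hQ.ne_top ((Ideal.eq_top_iff_one _).2 (hle ?_))
      rw [Submodule.mem_colon_singleton]
      simpa using hfn
    · refine (hQ.pow_le_iff (by omega : n ≠ 0)).1 (le_trans (fun g hg => ?_) hle)
      rw [Submodule.mem_colon_singleton]
      exact Ideal.mul_mem_right _ _ hg
  · rintro ⟨i, j, hij, rfl⟩
    obtain ⟨a, ha⟩ := exists_isCoverExceptAt (G := G) hn hij.ne
    exact ⟨isPrime_pairIdeal hij.ne, _, (colon_monomial_eq hij ha).symm⟩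

omit [Finite V] in
lemma maximal_pairIdeal {i j : V} (hij : G.Adj i j) :
    Maximal (· ∈ {Q : Ideal (MvPolynomial V K) | ∃ i j, G.Adj i j ∧ Q = Ideal.span {X i, X j}})
      (Ideal.span {X i, X j}) := by
  refine ⟨⟨i, j, hij, rfl⟩, ?_⟩
  rintro _ ⟨k, l, hkl, rfl⟩ hle
  exact (pairIdeal_le_pairIdeal hij.ne hkl.ne hle).ge

/-- The local `v`-number of a symbolic power of a cover ideal at the prime of an edge `ij` is at
most the degree of any exponent that is a cover except at `ij`. -/
lemma localVNumber_symbolicPower_le {i j : V} (hij : G.Adj i j) {n : ℕ} {a : V →₀ ℕ}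
    (ha : IsCoverExceptAt G n i j a) :
    localVNumber (homogeneousSubmodule V K) (Ideal.span {X i, X j})
      (symbolicPower (coverIdeal K G) n) ≤ a.degree :=
  Nat.sInf_le ⟨monomial a 1, isHomogeneous_monomial _ rfl, (colon_monomial_eq hij ha).symm⟩

lemma le_localVNumber_symbolicPower {i j : V} (hij : G.Adj i j) {n : ℕ} (hn : 1 ≤ n) {d : ℕ}
    (hd : ∀ a, IsCoverExceptAt G n i j a → d ≤ a.degree) :
    d ≤ localVNumber (homogeneousSubmodule V K) (Ideal.span {X i, X j})
      (symbolicPower (coverIdeal K G) n) := by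
  -- Nonemptiness is essential for a lower bound, since `sInf ∅ = 0` in `ℕ`.
  obtain ⟨a, ha⟩ := exists_isCoverExceptAt (G := G) hn hij.ne
  refine le_csInf ⟨_, monomial a 1, isHomogeneous_monomial _ rfl,
    (colon_monomial_eq hij ha).symm⟩ ?_
  rintro u ⟨f, hf, hcolon⟩
  obtain ⟨b, hb, hcov⟩ := exists_isCoverExceptAt_of_eq_colon hcolon hij
  have hdeg : b.degree = u := by
    rw [Finsupp.degree_eq_weight_one]
    exact hf (mem_support_iff.1 hb)
  exact (hd b hcov).trans hdeg.le

end AssociatedPrimes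

/-! ### The two minimal degrees on `K_m^s` and their slopes. -/

section PendantComplete

open MvPolynomial

lemma degree_pendant {m s : ℕ} (a : PendantVertex m s →₀ ℕ) :
    a.degree = ∑ i, (a (.inl i) + ∑ l, a (.inr (i, l))) := by
  rw [Finsupp.degree_eq_sum, Fintype.sum_sum_type, Fintype.sum_prod_type, Finset.sum_add_distrib]

lemma adj_inl_inl {m s : ℕ} {i j : Fin m} (h : i ≠ j) :
    (pendantComplete m s).Adj (.inl i) (.inl j) := h

lemma adj_inl_inr {m s : ℕ} (i : Fin m) (l : Fin s) :
    (pendantComplete m s).Adj (.inl i) (.inr (i, l)) := rfl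

lemma le_localVNumber_pendantEdge (K : Type*) [Field K] {m s n : ℕ} (hn : 1 ≤ n) (i : Fin m)
    (l : Fin s) :
    m * n ≤ localVNumber (pendantGrading K m s) (Ideal.span {X (.inl i), X (.inr (i, l))})
      (symbolicPower (coverIdeal K (pendantComplete m s)) n) + m := by
  rw [← Nat.sub_le_iff_le_add]
  refine le_localVNumber_symbolicPower (adj_inl_inr i l) hn fun a ha => ?_
  rw [degree_pendant, Nat.sub_le_iff_le_add]
  -- The stars partition the vertices, and the `l`-th pendant edge of each already has weight at
  -- least `n - 1`.
  have hstar : ∀ j : Fin m, n ≤ a (.inl j) + ∑ l, a (.inr (j, l)) + 1 := by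
    intro j
    have h1 := Finset.single_le_sum (fun _ _ => Nat.zero_le _)
      (Finset.mem_univ l) (f := fun l => a (.inr (j, l)))
    have h2 : n ≤ a (.inl j) + a (.inr (j, l)) + 1 := by
      by_cases hj : j = i
      · subst hj
        exact ha.1.ge
      · have := ha.2 _ _ (adj_inl_inr j l) (by simp [hj]) (by simp)
        omega
    omega
  calc m * n = ∑ _j : Fin m, n := by simp
    _ ≤ ∑ j : Fin m, (a (.inl j) + ∑ l, a (.inr (j, l)) + 1) := Finset.sum_le_sum fun j _ => hstar j
    _ = _ := by rw [Finset.sum_add_distrib]; simp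

lemma localVNumber_pendantEdge_le (K : Type*) [Field K] {m s n : ℕ} (hn : 1 ≤ n) (i : Fin m)
    (l : Fin s) :
    localVNumber (pendantGrading K m s) (Ideal.span {X (.inl i), X (.inr (i, l))})
      (symbolicPower (coverIdeal K (pendantComplete m s)) n) ≤ m * n + m * s := by
  -- Lowering the centre `i` to `n - 1` is repaired by a `1` on each of its leaves except `l`.
  let a : PendantVertex m s →₀ ℕ := Finsupp.equivFunOnFinite.symm
    (Sum.elim (fun j => if j = i then n - 1 else n)
      fun p => if p.1 = i ∧ p.2 ≠ l then 1 else 0)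
  have hl : ∀ j, a (.inl j) = if j = i then n - 1 else n := fun _ => rfl
  have hr : ∀ p, a (.inr p) = if p.1 = i ∧ p.2 ≠ l then 1 else 0 := fun _ => rfl
  have ha : IsCoverExceptAt (pendantComplete m s) n (.inl i) (.inr (i, l)) a := by
    refine ⟨?_, ?_⟩
    · rw [hl, hr]
      simp
      omega
    · have key : ∀ j k, (j, k) ≠ (i, l) → n ≤ a (.inl j) + a (.inr (j, k)) := by
        intro j k h
        rw [hl, hr]
        by_cases hj : j = i
        · subst hj
          have : k ≠ l := fun h' => h (by rw [h'])
          simp [this]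
          omega
        · simp [hj]
      rintro (j | ⟨j, p⟩) (k | ⟨k, q⟩) hadj h1 h2
      · have hjk : j ≠ k := hadj
        rw [hl, hl]
        split_ifs <;> omega
      · obtain rfl : j = k := hadj
        exact key j q fun h => h1 (by simp_all)
      · obtain rfl : k = j := hadj
        rw [add_comm]
        exact key k p fun h => h2 (by simp_all)
      · exact hadj.elim
  refine (localVNumber_symbolicPower_le (adj_inl_inr i l) ha).trans ?_
  rw [degree_pendant]
  calc ∑ j, (a (.inl j) + ∑ k, a (.inr (j, k))) ≤ ∑ _j : Fin m, (n + ∑ _k : Fin s, 1) := by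
        refine Finset.sum_le_sum fun j _ => add_le_add ?_ (Finset.sum_le_sum fun k _ => ?_)
        · rw [hl]
          split_ifs <;> omega
        · rw [hr]
          split_ifs <;> omega
    _ = m * n + m * s := by simp [mul_add]

lemma le_localVNumber_completeEdge (K : Type*) [Field K] {m s n : ℕ} (hn : 1 ≤ n) (hs : 1 ≤ s) :
    n - 1 + s * (n + 1) + m * n ≤
      localVNumber (pendantGrading K (m + 2) s) (Ideal.span {X (.inl 0), X (.inl 1)})
        (symbolicPower (coverIdeal K (pendantComplete (m + 2) s)) n) := by
  refine le_localVNumber_symbolicPower (adj_inl_inl (by simp)) hn fun a ha => ?_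
  rw [degree_pendant, Fin.sum_univ_succ, Fin.sum_univ_succ]
  have hedge : ∀ j l, n ≤ a (.inl j) + a (.inr (j, l)) := fun j l =>
    ha.2 _ _ (adj_inl_inr j l) (by simp) (by simp)
  have hstar : ∀ j, n ≤ a (.inl j) + ∑ l, a (.inr (j, l)) := fun j =>
    (hedge j ⟨0, hs⟩).trans (Nat.add_le_add_left (Finset.single_le_sum
      (f := fun l => a (.inr (j, l))) (fun _ _ => Nat.zero_le _) (Finset.mem_univ _)) _)
  -- Pairing the `l`-th leaves at `0` and `1` gives `2n` over two edges, of which the centres supply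
  -- only `n - 1`.
  have hpair : s * (n + 1) ≤ ∑ l : Fin s, a (.inr (0, l)) + ∑ l : Fin s, a (.inr (1, l)) := by
    rw [← Finset.sum_add_distrib]
    calc s * (n + 1) = ∑ _l : Fin s, (n + 1) := by simp
      _ ≤ _ := Finset.sum_le_sum fun l _ => by
        have h0 := hedge 0 l
        have h1 := hedge 1 l
        have := ha.1
        omega
  have hrest : m * n ≤ ∑ j : Fin m,
      (a (.inl j.succ.succ) + ∑ l, a (.inr (j.succ.succ, l))) := by
    calc m * n = ∑ _j : Fin m, n := by simp
      _ ≤ _ := Finset.sum_le_sum fun j _ => hstar _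
  have := ha.1
  rw [Fin.succ_zero_eq_one]
  omega

lemma localVNumber_completeEdge_le (K : Type*) [Field K] {m s n : ℕ} (hn : 1 ≤ n) :
    localVNumber (pendantGrading K (m + 2) s) (Ideal.span {X (.inl 0), X (.inl 1)})
        (symbolicPower (coverIdeal K (pendantComplete (m + 2) s)) n) ≤
      n - 1 + s * (n + 1) + m * n := by
  -- The ends `0` and `1` carry `0` and `n - 1`, so their leaves need `n` and `1`; this attains the
  -- lower bound exactly.
  let a : PendantVertex (m + 2) s →₀ ℕ := Finsupp.equivFunOnFinite.symm
    (Sum.elim (fun j => if j = 0 then 0 else if j = 1 then n - 1 else n)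
      fun p => if p.1 = 0 then n else if p.1 = 1 then 1 else 0)
  have hl : ∀ j, a (.inl j) = if j = 0 then 0 else if j = 1 then n - 1 else n := fun _ => rfl
  have hr : ∀ p, a (.inr p) = if p.1 = 0 then n else if p.1 = 1 then 1 else 0 := fun _ => rfl
  have ha : IsCoverExceptAt (pendantComplete (m + 2) s) n (.inl 0) (.inl 1) a := by
    refine ⟨?_, ?_⟩
    · rw [hl, hl]
      simp
      omega
    · have key : ∀ j k, n ≤ a (.inl j) + a (.inr (j, k)) := by
        intro j k
        rw [hl, hr]
        dsimp only
        split_ifs <;> omega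
      rintro (j | ⟨j, p⟩) (k | ⟨k, q⟩) hadj h1 h2
      · have hjk : j ≠ k := hadj
        rw [hl, hl]
        split_ifs <;> first | omega | simp_all
      · obtain rfl : j = k := hadj
        exact key j q
      · obtain rfl : k = j := hadj
        rw [add_comm]
        exact key k p
      · exact hadj.elim
  refine (localVNumber_symbolicPower_le (adj_inl_inl (by simp)) ha).trans ?_
  rw [degree_pendant, Fin.sum_univ_succ, Fin.sum_univ_succ]
  have h2 : ∀ j : Fin m, j.succ.succ ≠ 1 := fun j h =>
    Fin.succ_ne_zero j (Fin.succ_injective _ h)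
  simp only [hl, hr, Fin.succ_zero_eq_one, Fin.succ_ne_zero, h2, if_true, if_false,
    Finset.sum_const, Finset.card_univ, Fintype.card_fin, smul_eq_mul, one_ne_zero, mul_add]
  omega

lemma tendsto_div_of_bounded_sub {v : ℕ → ℕ} {c d : ℕ} (h1 : ∀ n, 1 ≤ n → c * n ≤ v n + d)
    (h2 : ∀ n, 1 ≤ n → v n ≤ c * n + d) :
    Tendsto (fun n : ℕ => (v n : ℝ) / n) atTop (𝓝 c) := by
  rw [← tendsto_sub_nhds_zero_iff]
  refine squeeze_zero_norm' ?_ (tendsto_const_div_atTop_nhds_zero_nat (d : ℝ))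
  filter_upwards [eventually_ge_atTop 1] with n hn
  have hn' : (0 : ℝ) < n := by exact_mod_cast hn
  have h1' : (c * n : ℝ) ≤ v n + d := by exact_mod_cast h1 n hn
  have h2' : (v n : ℝ) ≤ c * n + d := by exact_mod_cast h2 n hn
  rw [Real.norm_eq_abs, div_sub' hn'.ne', abs_div, abs_of_pos hn']
  gcongr
  rw [abs_le]
  constructor <;> linarith

/-- The factor `r` serves both parts: `r = 1` for symbolic powers, `r = 2t` for ordinary powers of
`J^(2t)`. -/
lemma tendsto_localVNumber_pendantEdge (K : Type*) [Field K] {m s : ℕ} (i : Fin m) (l : Fin s)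
    {r : ℕ} (hr : 1 ≤ r) :
    Tendsto (fun n : ℕ => (localVNumber (pendantGrading K m s)
      (Ideal.span {X (.inl i), X (.inr (i, l))})
      (symbolicPower (coverIdeal K (pendantComplete m s)) (r * n)) : ℝ) / n)
      atTop (𝓝 (m * r : ℕ)) := by
  refine tendsto_div_of_bounded_sub (d := m + m * s) (fun n hn => ?_) fun n hn => ?_
  · have := le_localVNumber_pendantEdge K (Nat.mul_pos hr hn) i l
    rw [mul_assoc]
    omega
  · have := localVNumber_pendantEdge_le K (Nat.mul_pos hr hn) i l
    rw [mul_assoc]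
    omega

lemma tendsto_localVNumber_completeEdge (K : Type*) [Field K] {m s : ℕ} (hs : 1 ≤ s)
    {r : ℕ} (hr : 1 ≤ r) :
    Tendsto (fun n : ℕ => (localVNumber (pendantGrading K (m + 2) s)
      (Ideal.span {X (.inl 0), X (.inl 1)})
      (symbolicPower (coverIdeal K (pendantComplete (m + 2) s)) (r * n)) : ℝ) / n)
      atTop (𝓝 ((m + 1 + s) * r : ℕ)) := by
  refine tendsto_div_of_bounded_sub (d := s + 1) (fun n hn => ?_) fun n hn => ?_
  · have := le_localVNumber_completeEdge K (m := m) (Nat.mul_pos hr hn) hs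
    rw [mul_assoc, add_mul, add_mul]
    rw [mul_add] at this
    omega
  · have := localVNumber_completeEdge_le K (m := m) (s := s) (Nat.mul_pos hr hn)
    rw [mul_assoc, add_mul, add_mul]
    rw [mul_add] at this
    omega

end PendantComplete

/-! ### Stable associated primes and the final assembly. -/

lemma stableAss_eq_of_forall {R : Type*} [CommRing R] {I : ℕ → Ideal R} {S : Set (Ideal R)}
    (h : ∀ n, 1 ≤ n → associatedPrimes R (R ⧸ I n) = S) : stableAss I = S := by
  ext P
  constructor
  · intro hP
    obtain ⟨n, hn, hn1⟩ := (hP.and (eventually_ge_atTop 1)).exists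
    rwa [h n hn1] at hn
  · intro hP
    refine (eventually_ge_atTop 1).mono fun n hn => ?_
    rwa [h n hn]

lemma assStabilizes_of_forall {R : Type*} [CommRing R] {I : ℕ → Ideal R} {S : Set (Ideal R)}
    (h : ∀ n, 1 ≤ n → associatedPrimes R (R ⧸ I n) = S) : AssStabilizes I :=
  (eventually_ge_atTop 1).mono fun n hn => (h n hn).trans (h (n + 1) (by omega)).symm

theorem corollary4p9 (K : Type*) [Field K] (t m : ℕ) (ht : 1 ≤ t) (hm : 2 ≤ m) :
    -- part (1): the symbolic powers of the cover ideal of `K_m^(t+1)`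
    (let I : ℕ → Ideal (PendantRing K m (t + 1)) :=
       symbolicPower (coverIdeal K (pendantComplete m (t + 1)))
     IsNoetherianFiltration I ∧
     (∀ n, (I n).IsHomogeneous (pendantGrading K m (t + 1))) ∧
     AssStabilizes I ∧
     ∃ P Q : Ideal (PendantRing K m (t + 1)),
       (∀ᶠ n in atTop,
         Maximal (· ∈ associatedPrimes (PendantRing K m (t + 1))
           (PendantRing K m (t + 1) ⧸ I n)) P) ∧
       (∀ᶠ n in atTop,
         Maximal (· ∈ associatedPrimes (PendantRing K m (t + 1))
           (PendantRing K m (t + 1) ⧸ I n)) Q) ∧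
       ∃ a b : ℝ,
         Tendsto (fun n : ℕ => (localVNumber (pendantGrading K m (t + 1)) P (I n) : ℝ) / n)
           atTop (𝓝 a) ∧
         Tendsto (fun n : ℕ => (localVNumber (pendantGrading K m (t + 1)) Q (I n) : ℝ) / n)
           atTop (𝓝 b) ∧
         b - a = t) ∧
    -- part (2): the ordinary powers of `J^(2t)`, for `J` the cover ideal of `K_m^s`
    (∀ s : ℕ, 2 ≤ s →
      let I : Ideal (PendantRing K m s) :=
        symbolicPower (coverIdeal K (pendantComplete m s)) (2 * t)
      I.IsHomogeneous (pendantGrading K m s) ∧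
      AssStabilizes (fun n => I ^ n) ∧
      ∃ P Q : Ideal (PendantRing K m s),
        Maximal (· ∈ stableAss (fun n => I ^ n)) P ∧
        Maximal (· ∈ stableAss (fun n => I ^ n)) Q ∧
        ∃ a b : ℝ,
          Tendsto (fun n : ℕ => (localVNumber (pendantGrading K m s) P (I ^ n) : ℝ) / n)
            atTop (𝓝 a) ∧
          Tendsto (fun n : ℕ => (localVNumber (pendantGrading K m s) Q (I ^ n) : ℝ) / n)
            atTop (𝓝 b) ∧
          a ≠ b) := by
  obtain ⟨m, rfl⟩ := Nat.exists_eq_add_of_le' hm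
  refine ⟨⟨isNoetherianFiltration_symbolicPower_coverIdeal,
    isHomogeneous_symbolicPower_coverIdeal,
    assStabilizes_of_forall fun n hn => associatedPrimes_symbolicPower_coverIdeal hn,
    Ideal.span {MvPolynomial.X (.inl 0), MvPolynomial.X (.inr (0, 0))},
    Ideal.span {MvPolynomial.X (.inl 0), MvPolynomial.X (.inl 1)}, ?_, ?_,
    (m + 2 : ℕ), (m + 1 + (t + 1) : ℕ), ?_, ?_, ?_⟩, fun s hs => ?_⟩
  rotate_left 2
  · simpa only [one_mul, mul_one] using
      tendsto_localVNumber_pendantEdge K (m := m + 2) (s := t + 1) 0 0 le_rfl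
  · simpa only [one_mul, mul_one] using
      tendsto_localVNumber_completeEdge K (m := m) (s := t + 1) (by omega) le_rfl
  · push_cast
    ring
  · intro I
    have hAss : ∀ n, 1 ≤ n → associatedPrimes (PendantRing K (m + 2) s)
        (PendantRing K (m + 2) s ⧸ I ^ n) = {Q | ∃ i j, (pendantComplete (m + 2) s).Adj i j ∧
          Q = Ideal.span {MvPolynomial.X i, MvPolynomial.X j}} := fun n hn => by
      rw [symbolicPower_coverIdeal_two_mul_pow]
      exact associatedPrimes_symbolicPower_coverIdeal (Nat.mul_pos (by omega) hn)
    refine ⟨isHomogeneous_symbolicPower_coverIdeal _, assStabilizes_of_forall hAss,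
      Ideal.span {MvPolynomial.X (.inl 0), MvPolynomial.X (.inr (0, ⟨0, by omega⟩))},
      Ideal.span {MvPolynomial.X (.inl 0), MvPolynomial.X (.inl 1)}, ?_, ?_,
      ((m + 2) * (2 * t) : ℕ), ((m + 1 + s) * (2 * t) : ℕ), ?_, ?_, ?_⟩
    · rw [stableAss_eq_of_forall hAss]
      exact maximal_pairIdeal (adj_inl_inr _ _)
    · rw [stableAss_eq_of_forall hAss]
      exact maximal_pairIdeal (adj_inl_inl (by simp))
    · simp only [I, symbolicPower_coverIdeal_two_mul_pow]
      exact tendsto_localVNumber_pendantEdge K _ _ (by omega)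
    · simp only [I, symbolicPower_coverIdeal_two_mul_pow]
      exact tendsto_localVNumber_completeEdge K (by omega) (by omega)
    -- Cancelling `2t` leaves `m + 2 = m + 1 + s`, impossible for `s ≥ 2`.
    · rw [Ne, Nat.cast_inj]
      intro h
      have := Nat.eq_of_mul_eq_mul_right (by omega : 0 < 2 * t) h
      omega
  · filter_upwards [eventually_ge_atTop 1] with n hn
    rw [associatedPrimes_symbolicPower_coverIdeal hn]
    exact maximal_pairIdeal (adj_inl_inr _ _)
  · filter_upwards [eventually_ge_atTop 1] with n hn
    rw [associatedPrimes_symbolicPower_coverIdeal hn]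
    exact maximal_pairIdeal (adj_inl_inl (by simp))
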